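/- A \emph{surface group} is a group isomorphic to the fundamental group $\langle a_1,b_1,\dots,a_g,b_g \mid [a_1,b_1]\cdots[a_g,b_g]=1\rangle$ of a closed oriented surface of genus $g\ge 2$. For an extension of groups $1\to R\to E\to B\to 1$, the \emph{monodromy} is the morphism $B\to \mathrm{Out}(R)=\mathrm{Aut}(R)/\mathrm{Inn}(R)$ induced by the conjugation action of $E$ on $R$. A group $N$ is \emph{surface-by-surface with injective monodromy} if it has a normal subgroup $A$ such that $A$ and $N/A$ are surface groups and the monodromy $N/A\to\mathrm{Out}(A)$ of $1\to A\to N\to N/A\to 1$ is injective. Let $1\to N\to G\xrightarrow{p} Q\to 1$ be an exact sequence of groups, where $N$ is surface-by-surface with injective monodromy. For $i=1,2$ let $1\to R_i\to H_i\xrightarrow{p_i} Q\to 1$ be an exact sequence of groups with injective monodromy, where $R_i$ is a surface group. Let $f_i:G\to H_i$ and $u_i:N\to R_i$ ($i=1,2$) be surjective morphisms such that $p_i\circ f_i=p$, and such that the restriction of $f_i$ to $N$ is $u_i$ followed by the inclusion $R_i\to H_i$. Assume that $\mathrm{Ker}(u_1)$ and $\mathrm{Ker}(u_2)$ are surface groups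 and that $\mathrm{Ker}(u_1)\neq \mathrm{Ker}(u_2)$. Then, for $i=1$ and for $i=2$, the sequence $1\to \mathrm{Ker}(u_i)\to G\xrightarrow{f_i} H_i\to 1$ is exact and its monodromy $H_i\to \mathrm{Out}(\mathrm{Ker}(u_i))$ is injective. -/

import Mathlib

/-- The surface relator `[a₁,b₁] ⋯ [a_g,b_g]` in the free group on `a₁, …, a_g, b₁, …, b_g`
(`aᵢ` is the generator `Sum.inl i`, and `bᵢ` is the generator `Sum.inr i`). -/
def surfaceRelator (g : ℕ) : FreeGroup (Fin g ⊕ Fin g) :=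
  (List.ofFn fun i : Fin g =>
    FreeGroup.of (Sum.inl i) * FreeGroup.of (Sum.inr i) *
      (FreeGroup.of (Sum.inl i))⁻¹ * (FreeGroup.of (Sum.inr i))⁻¹).prod

/-- A surface group: a group isomorphic to the fundamental group
`⟨a₁, b₁, …, a_g, b_g ∣ [a₁,b₁] ⋯ [a_g,b_g]⟩` of the closed oriented surface of some genus
`g ≥ 2`. -/
def IsSurfaceGroup (R : Type*) [Group R] : Prop :=
  ∃ g : ℕ, 2 ≤ g ∧
    Nonempty (R ≃* PresentedGroup ({surfaceRelator g} : Set (FreeGroup (Fin g ⊕ Fin g))))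

instance innerAutomorphisms_normal (R : Type*) [Group R] :
    (MulAut.conj : R →* MulAut R).range.Normal where
  conj_mem := by
    rintro _ ⟨r, rfl⟩ φ
    exact ⟨φ r, by ext x; simp [MulAut.mul_apply]⟩

/-- The group `Out(R) = Aut(R) / Inn(R)` of outer automorphisms. -/
abbrev OuterAut (R : Type*) [Group R] : Type _ :=
  MulAut R ⧸ (MulAut.conj : R →* MulAut R).range

namespace GroupExtension

/-- The conjugation action of the middle group on the kernel, taken modulo inner
automorphisms of the kernel. -/
noncomputable def outerConj {R G Q : Type*} [Group R] [Group G] [Group Q]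
    (S : GroupExtension R G Q) : G →* OuterAut R :=
  (QuotientGroup.mk' (MulAut.conj : R →* MulAut R).range).comp S.conjAct

theorem ker_rightHom_le_ker_outerConj {R G Q : Type*} [Group R] [Group G] [Group Q]
    (S : GroupExtension R G Q) : S.rightHom.ker ≤ S.outerConj.ker := by
  intro x hx
  rw [← S.range_inl_eq_ker_rightHom] at hx
  obtain ⟨r, rfl⟩ := hx
  rw [MonoidHom.mem_ker, outerConj, MonoidHom.comp_apply, QuotientGroup.mk'_apply,
    QuotientGroup.eq_one_iff]
  refine ⟨r, ?_⟩
  ext x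
  apply S.inl_injective
  rw [S.inl_conjAct_comm]
  simp

/-- The monodromy morphism `Q → Out(R)` of an extension `1 → R → G → Q → 1`: an element of `Q`
goes to the class of the conjugation by any of its lifts to `G`
(see `GroupExtension.monodromy_rightHom`). -/
noncomputable def monodromy {R G Q : Type*} [Group R] [Group G] [Group Q]
    (S : GroupExtension R G Q) : Q →* OuterAut R :=
  S.rightHom.liftOfSurjective S.rightHom_surjective
    ⟨S.outerConj, S.ker_rightHom_le_ker_outerConj⟩

theorem monodromy_rightHom {R G Q : Type*} [Group R] [Group G] [Group Q]
    (S : GroupExtension R G Q) (x : G) :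
    S.monodromy (S.rightHom x) = QuotientGroup.mk (S.conjAct x) :=
  S.rightHom.liftOfRightInverse_comp_apply _ (Function.rightInverse_surjInv _)
    ⟨S.outerConj, S.ker_rightHom_le_ker_outerConj⟩ x

/-- The extension `1 → A → G → G ⧸ A → 1` given by a normal subgroup `A` of `G`. -/
def ofNormal {G : Type*} [Group G] (A : Subgroup G) [A.Normal] : GroupExtension A G (G ⧸ A) where
  inl := A.subtype
  rightHom := QuotientGroup.mk' A
  inl_injective := A.subtype_injective
  range_inl_eq_ker_rightHom := by simp
  rightHom_surjective := QuotientGroup.mk'_surjective A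

/-- A morphism of extensions with the same quotient
```
1 → N → G → Q → 1
    ↓u  ↓f  ‖
1 → R → H → Q → 1
```
with `f` surjective gives an extension `1 → Ker u → G → H → 1`, whose projection is `f` and whose
inclusion is the restriction of `N → G` to `Ker u`. -/
def kerExtension {N G Q R H : Type*} [Group N] [Group G] [Group Q] [Group R] [Group H]
    (S : GroupExtension N G Q) (T : GroupExtension R H Q) (u : N →* R) (f : G →* H)
    (hf : Function.Surjective f) (hleft : f.comp S.inl = T.inl.comp u)
    (hright : T.rightHom.comp f = S.rightHom) : GroupExtension u.ker G H where
  inl := S.inl.comp u.ker.subtype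
  rightHom := f
  inl_injective := S.inl_injective.comp u.ker.subtype_injective
  range_inl_eq_ker_rightHom := by
    have hl : ∀ n, f (S.inl n) = T.inl (u n) := fun n => DFunLike.congr_fun hleft n
    ext x
    constructor
    · rintro ⟨n, rfl⟩
      have hn : u n = 1 := n.2
      simp [MonoidHom.mem_ker, hl, hn]
    · intro hx
      rw [MonoidHom.mem_ker] at hx
      have hS : x ∈ S.rightHom.ker := by
        rw [MonoidHom.mem_ker, ← hright, MonoidHom.comp_apply, hx, map_one]
      rw [← S.range_inl_eq_ker_rightHom] at hS
      obtain ⟨n, rfl⟩ := hS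
      rw [hl] at hx
      exact ⟨⟨n, T.inl_injective (by rw [hx, map_one])⟩, rfl⟩
  rightHom_surjective := hf

end GroupExtension

/-- `N` is a surface-by-surface group with injective monodromy: it has a normal subgroup `A` such
that `A` and `N ⧸ A` are surface groups and the monodromy `N ⧸ A → Out(A)` is injective. -/
def IsSurfaceBySurfaceWithInjectiveMonodromy (N : Type*) [Group N] : Prop :=
  ∃ (A : Subgroup N) (_ : A.Normal), IsSurfaceGroup A ∧ IsSurfaceGroup (N ⧸ A) ∧
    Function.Injective (GroupExtension.ofNormal A).monodromy

/-!
An element `z` of `G` that acts on `Ker u₁` as an inner automorphism differs from an element of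
`Ker u₁` by an element of the centralizer of `Ker u₁` in `G`, so it suffices that this centralizer
is trivial (`eq_one_of_commute_ker`). Two facts about a surface group `R` are used.

* Two commuting normal subgroups of `R` are not both nontrivial
  (`IsSurfaceGroup.false_of_commute`); in particular nontrivial normal subgroups have trivial
  centralizer.
* A nontrivial finitely generated normal subgroup of `R` is not killed by a surjection to `ℤ`
  (`IsSurfaceGroup.eq_bot_of_fg_of_le_ker`); so `Ker u₁` and `Ker u₂`, being distinct, are not
  nested (`ker_eq_of_ker_le`).

Let `z` centralize `Ker u₁`. Then `f₂ z` centralizes the nontrivial normal subgroup `u₂ (Ker u₁)` of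
`R₂`, hence centralizes `R₂`, and injectivity of the monodromy of `H₂` puts `z` in `N`, then in
`Ker u₂`. If `z ≠ 1`, the normal subgroup `Ker u₁ ∩ Ker u₂` of `Ker u₂` commutes with `z`, so it is
trivial, and `Ker u₁` and `Ker u₂` centralize each other. This is impossible in `N`: its fiber `A` has
trivial centralizer, so it meets both kernels nontrivially, in commuting normal subgroups of `A`.

Both facts follow from counting crossed homomorphisms. As `R` has one relation and at least four
generators, its crossed homomorphisms to a representation `W` form a space of dimension at least
`3 dim W`, so that nonzero ones satisfy any given linear condition with values in `W`
(`IsSurfaceGroup.exists_crossedHom`). On the other hand, if a normal subgroup violates one of the two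
facts and `W` is a (twisted) representation in which it fixes no nonzero vector, some such condition
forces a crossed homomorphism to vanish on it, and then everywhere.

The representations `W` come from finite quotients, because surface groups are residually finite.
Let `χ` be the map to `ℤ` sending `a₀` to `1` and the other generators to `0`. The relation reads
`a₀ b₀ a₀⁻¹ = c⁻¹ b₀`, where `c` is the product of the commutators of the other handles, so `Ker χ`
is generated by `b₀` and the conjugates by powers of `a₀` of the generators of the other handles.
A homomorphism to a finite group `P` from the free group on these symbols, cut off to be periodic of
period `ℓ`, is realized inside a permutation action of the whole surface group on the finite set
`ZMod ℓ × P × P` (`towerHom`), whose middle coordinate keeps track of the value at `b₀`. Thus residual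
finiteness reduces to that of free groups.
-/

/-! ### Free groups are residually finite -/

/-- On a finite subset `B` of a group, left multiplication by `g` is an injective partial map,
hence it extends to a permutation of `B`. -/
theorem exists_perm_extending_mul_left {G : Type*} [Group G] (B : Set G) [Finite B] (g : G) :
    ∃ σ : Equiv.Perm B, ∀ (x : B) (h : g * x ∈ B), σ x = ⟨g * x, h⟩ := by
  classical
  have : Fintype B := Fintype.ofFinite B
  let e : {x : B // g * x ∈ B} ≃ {y : B // g⁻¹ * y ∈ B} :=
    { toFun := fun x => ⟨⟨g * x.1, x.2⟩, by simp⟩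
      invFun := fun y => ⟨⟨g⁻¹ * y.1, y.2⟩, by simp⟩
      left_inv := fun x => by simp
      right_inv := fun y => by simp }
  exact ⟨e.extendSubtype, fun x h => e.extendSubtype_apply_of_mem x h⟩

instance freeGroup_residuallyFinite {α : Type*} : Group.ResiduallyFinite (FreeGroup α) := by
  classical
  refine Group.residuallyFinite_of_forall_exists_finite_monoidHom fun w hw => ?_
  -- The elements represented by the suffixes of a word for `w`; the word leads from `1` to `w`
  -- inside this set.
  let B : Set (FreeGroup α) := {x | ∃ s ∈ w.toWord.tails, FreeGroup.mk s = x}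
  have hB : B.Finite := (List.finite_toSet w.toWord.tails).image FreeGroup.mk
  have : Finite B := hB
  choose σ hσ using fun a : α => exists_perm_extending_mul_left B (FreeGroup.of a)
  have h1 : (1 : FreeGroup α) ∈ B := ⟨[], by simp, rfl⟩
  have hmem : ∀ s : List (α × Bool), s <:+ w.toWord → FreeGroup.mk s ∈ B := fun s hs =>
    ⟨s, by simpa using hs, rfl⟩
  have key : ∀ s : List (α × Bool), s <:+ w.toWord →
      ((FreeGroup.lift σ (FreeGroup.mk s) ⟨1, h1⟩ : B) : FreeGroup α) = FreeGroup.mk s := by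
    intro s
    induction s with
    | nil =>
      intro _
      rw [show (FreeGroup.mk [] : FreeGroup α) = 1 from rfl, map_one, Equiv.Perm.one_apply]
    | cons x s ih =>
      intro hsuf
      have hsuf' : s <:+ w.toWord := (List.suffix_cons x s).trans hsuf
      have ih' : FreeGroup.lift σ (FreeGroup.mk s) ⟨1, h1⟩ = ⟨FreeGroup.mk s, hmem s hsuf'⟩ :=
        Subtype.ext (ih hsuf')
      have hs := hmem _ hsuf
      have hmul : FreeGroup.mk (x :: s) = FreeGroup.mk [x] * FreeGroup.mk s := by
        rw [FreeGroup.mul_mk]; rfl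
      obtain ⟨a, e⟩ := x
      cases e with
      | true =>
        replace hmul : FreeGroup.mk ((a, true) :: s) = FreeGroup.of a * FreeGroup.mk s := hmul
        rw [hmul] at hs ⊢
        rw [map_mul, Equiv.Perm.mul_apply, FreeGroup.lift_apply_of, ih', hσ a _ hs]
      | false =>
        replace hmul : FreeGroup.mk ((a, false) :: s) = (FreeGroup.of a)⁻¹ * FreeGroup.mk s := hmul
        rw [hmul] at hs ⊢
        rw [map_mul, Equiv.Perm.mul_apply, map_inv, FreeGroup.lift_apply_of, ih']
        have hback : σ a ⟨_, hs⟩ = ⟨FreeGroup.mk s, hmem s hsuf'⟩ :=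
          (hσ a ⟨_, hs⟩ (by simpa using hmem s hsuf')).trans (by simp)
        rw [← hback]
        exact congrArg Subtype.val (Equiv.symm_apply_apply (σ a) ⟨_, hs⟩)
  refine ⟨Equiv.Perm B, inferInstance, inferInstance, FreeGroup.lift σ, fun h => hw ?_⟩
  have := key w.toWord List.suffix_rfl
  rw [FreeGroup.mk_toWord, h] at this
  exact this.symm

/-! ### Permutation actions of surface groups -/

/-- The relator evaluated on a family of elements of a group. -/
theorem lift_surfaceRelator {G : Type*} [Group G] {g : ℕ} (f : Fin g ⊕ Fin g → G) :
    FreeGroup.lift f (surfaceRelator g) = (List.ofFn fun i : Fin g =>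
      f (Sum.inl i) * f (Sum.inr i) * (f (Sum.inl i))⁻¹ * (f (Sum.inr i))⁻¹).prod := by
  rw [surfaceRelator, map_list_prod, List.map_ofFn]
  congr 2
  ext i
  simp

section Tower

variable {k ℓ : ℕ} {P : Type*} [Group P]

/-- A family `h` of elements of `P` indexed by `ZMod ℓ × P` acts on `ZMod ℓ × P × P`
by left multiplication on the last factor. -/
def fiberPerm (ℓ : ℕ) (P : Type*) [Group P] :
    (ZMod ℓ → P → P) →* Equiv.Perm (ZMod ℓ × P × P) where
  toFun h :=
    { toFun := fun x => (x.1, x.2.1, h x.1 x.2.1 * x.2.2)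
      invFun := fun x => (x.1, x.2.1, (h x.1 x.2.1)⁻¹ * x.2.2)
      left_inv := fun x => by simp
      right_inv := fun x => by simp }
  map_one' := by ext x <;> simp
  map_mul' h h' := by ext x <;> simp [mul_assoc]

theorem fiberPerm_apply (h : ZMod ℓ → P → P) (x : ZMod ℓ × P × P) :
    fiberPerm ℓ P h x = (x.1, x.2.1, h x.1 x.2.1 * x.2.2) := rfl

/-- Given `W : ZMod ℓ → P`, the permutation `(n, β, p) ↦ (n + 1, W (n + 1) β, p)`. -/
def stepPerm (W : ZMod ℓ → P) : Equiv.Perm (ZMod ℓ × P × P) where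
  toFun x := (x.1 + 1, W (x.1 + 1) * x.2.1, x.2.2)
  invFun x := (x.1 - 1, (W x.1)⁻¹ * x.2.1, x.2.2)
  left_inv x := by simp
  right_inv x := by simp

theorem stepPerm_apply (W : ZMod ℓ → P) (x : ZMod ℓ × P × P) :
    stepPerm W x = (x.1 + 1, W (x.1 + 1) * x.2.1, x.2.2) := rfl

theorem stepPerm_symm_apply (W : ZMod ℓ → P) (x : ZMod ℓ × P × P) :
    (stepPerm W).symm x = (x.1 - 1, (W x.1)⁻¹ * x.2.1, x.2.2) := rfl

theorem stepPerm_zpow_apply_fst (W : ZMod ℓ → P) (m : ℤ) (x : ZMod ℓ × P × P) :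
    ((stepPerm W ^ m) x).1 = x.1 + m := by
  induction m with
  | zero => simp
  | succ m ih =>
    rw [add_comm, zpow_add, zpow_one, Equiv.Perm.mul_apply, stepPerm_apply, ih]
    push_cast; ring
  | pred m ih =>
    rw [sub_eq_neg_add, zpow_add, zpow_neg_one, Equiv.Perm.mul_apply,
      show (stepPerm W)⁻¹ = (stepPerm W).symm from rfl, stepPerm_symm_apply, ih]
    push_cast; ring

theorem stepPerm_conj_fiberPerm (W : ZMod ℓ → P) (h : ZMod ℓ → P) :
    stepPerm W * fiberPerm ℓ P (fun n _ => h n) * (stepPerm W)⁻¹ =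
      fiberPerm ℓ P (fun n _ => h (n - 1)) := by
  ext x <;>
  simp [fiberPerm_apply, stepPerm_apply, stepPerm_symm_apply]

theorem stepPerm_zpow_conj_fiberPerm (W : ZMod ℓ → P) (m : ℤ) (h : ZMod ℓ → P) :
    stepPerm W ^ m * fiberPerm ℓ P (fun n _ => h n) * (stepPerm W ^ m)⁻¹ =
      fiberPerm ℓ P (fun n _ => h (n - m)) := by
  induction m generalizing h with
  | zero => simp
  | succ m ih =>
    rw [zpow_add, zpow_one, mul_inv_rev]
    have := ih (fun n => h (n - 1))
    rw [← stepPerm_conj_fiberPerm W h] at this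
    convert this using 1
    · group
    · congr 1; ext n β; congr 1; push_cast; ring
  | pred m ih =>
    rw [zpow_sub, zpow_one, mul_inv_rev, inv_inv]
    have := ih (fun n => h (n + 1))
    have h2 := stepPerm_conj_fiberPerm W (fun n => h (n + 1))
    simp only [sub_add_cancel] at h2
    rw [← eq_mul_inv_iff_mul_eq, inv_inv, ← eq_inv_mul_iff_mul_eq] at h2
    rw [h2] at this
    convert this using 1
    · group
    · congr 1; ext n β; congr 1; push_cast; ring

/-- The value at height `n` of the product of the commutators of the handles other than
the first one. -/
def handleProd (θ : Fin k ⊕ Fin k → ZMod ℓ → P) (n : ZMod ℓ) : P :=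
  (List.ofFn fun i : Fin k =>
    θ (Sum.inl i) n * θ (Sum.inr i) n * (θ (Sum.inl i) n)⁻¹ * (θ (Sum.inr i) n)⁻¹).prod

/-- The images of the generators of the surface group of genus `k + 1` under `towerHom`. -/
def towerGen (θ : Fin k ⊕ Fin k → ZMod ℓ → P) :
    Fin (k + 1) ⊕ Fin (k + 1) → Equiv.Perm (ZMod ℓ × P × P) :=
  Sum.elim
    (Fin.cons (stepPerm (handleProd θ)) fun i => fiberPerm ℓ P fun n _ => θ (Sum.inl i) n)
    (Fin.cons (fiberPerm ℓ P fun _ β => β) fun i => fiberPerm ℓ P fun n _ => θ (Sum.inr i) n)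

theorem lift_towerGen_surfaceRelator (θ : Fin k ⊕ Fin k → ZMod ℓ → P) :
    FreeGroup.lift (towerGen θ) (surfaceRelator (k + 1)) = 1 := by
  have hW : (List.ofFn fun i : Fin k =>
      towerGen θ (Sum.inl i.succ) * towerGen θ (Sum.inr i.succ) *
        (towerGen θ (Sum.inl i.succ))⁻¹ * (towerGen θ (Sum.inr i.succ))⁻¹).prod =
      fiberPerm ℓ P fun n _ => handleProd θ n := by
    have : (fun n _ => handleProd θ n : ZMod ℓ → P → P) = (List.ofFn fun i : Fin k =>
        (fun n _ => θ (Sum.inl i) n * θ (Sum.inr i) n * (θ (Sum.inl i) n)⁻¹ *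
          (θ (Sum.inr i) n)⁻¹ : ZMod ℓ → P → P)).prod := by
      ext n β
      let ev : (ZMod ℓ → P → P) →* P :=
        (Pi.evalMonoidHom (fun _ : P => P) β).comp (Pi.evalMonoidHom (fun _ : ZMod ℓ => P → P) n)
      refine Eq.trans ?_ (map_list_prod ev _).symm
      rw [List.map_ofFn]
      rfl
    rw [this, map_list_prod, List.map_ofFn]
    congr 2
    ext1 i
    simp only [towerGen, Sum.elim_inl, Sum.elim_inr, Fin.cons_succ, ← map_mul, ← map_inv]
    rfl
  rw [lift_surfaceRelator, List.ofFn_succ, List.prod_cons, hW]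
  ext x <;>
  simp [towerGen, fiberPerm_apply, stepPerm_apply, stepPerm_symm_apply, ← map_inv]

/-- The action of the surface group of genus `k + 1` on `ZMod ℓ × P × P` attached to
`θ : Fin k ⊕ Fin k → ZMod ℓ → P`. The generator `a₀` moves the height `n ∈ ZMod ℓ` by one, the
generators of the other handles act on the fiber at height `n` through `θ · n`, and `b₀` acts on
that fiber through the middle coordinate, which `a₀` updates as the relation
`a₀ b₀ a₀⁻¹ = W⁻¹ b₀` demands, where `W` is the product of the other commutators. -/
def towerHom (θ : Fin k ⊕ Fin k → ZMod ℓ → P) :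
    PresentedGroup ({surfaceRelator (k + 1)} : Set (FreeGroup (Fin (k + 1) ⊕ Fin (k + 1)))) →*
      Equiv.Perm (ZMod ℓ × P × P) :=
  PresentedGroup.toGroup (f := towerGen θ) (by
    rintro _ rfl
    exact lift_towerGen_surfaceRelator θ)

end Tower

/-! ### The infinite cyclic cover -/

section CyclicCover

variable (k : ℕ)

/-- The surface group of genus `g`, given by its standard presentation. -/
abbrev StdSurfaceGroup (g : ℕ) : Type :=
  PresentedGroup ({surfaceRelator g} : Set (FreeGroup (Fin g ⊕ Fin g)))

/-- The generator `aᵢ` (for `Sum.inl i`) or `bᵢ` (for `Sum.inr i`) of the handle `i + 1`. -/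
def handleGen (j : Fin k ⊕ Fin k) : StdSurfaceGroup (k + 1) :=
  PresentedGroup.of (Sum.map Fin.succ Fin.succ j)

/-- The generator `a₀`. -/
def stableGen : StdSurfaceGroup (k + 1) := PresentedGroup.of (Sum.inl 0)

/-- The generator `b₀`. -/
def dualGen : StdSurfaceGroup (k + 1) := PresentedGroup.of (Sum.inr 0)

/-- The map from the free group on `b₀` and the conjugates `a₀ⁿ x a₀⁻ⁿ`, for `n : ℤ` and `x` a
generator of another handle. -/
def coverHom : FreeGroup (Option ((Fin k ⊕ Fin k) × ℤ)) →* StdSurfaceGroup (k + 1) :=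
  FreeGroup.lift fun o => o.elim (dualGen k)
    fun x => stableGen k ^ x.2 * handleGen k x.1 * (stableGen k ^ x.2)⁻¹

/-- The product of the commutators of the handles other than the first one. -/
def handleRelator : StdSurfaceGroup (k + 1) :=
  (List.ofFn fun i : Fin k => handleGen k (Sum.inl i) * handleGen k (Sum.inr i) *
    (handleGen k (Sum.inl i))⁻¹ * (handleGen k (Sum.inr i))⁻¹).prod

theorem stableGen_conj_dualGen :
    stableGen k * dualGen k * (stableGen k)⁻¹ = (handleRelator k)⁻¹ * dualGen k := by
  have h : FreeGroup.lift PresentedGroup.of (surfaceRelator (k + 1)) =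
      (1 : StdSurfaceGroup (k + 1)) := by
    have h1 : FreeGroup.lift PresentedGroup.of =
        PresentedGroup.mk ({surfaceRelator (k + 1)} : Set (FreeGroup _)) := by
      ext x; simp [PresentedGroup.of]
    rw [h1]
    exact PresentedGroup.one_of_mem rfl
  rw [lift_surfaceRelator, List.ofFn_succ, List.prod_cons] at h
  replace h : stableGen k * dualGen k * (stableGen k)⁻¹ * (dualGen k)⁻¹ * handleRelator k = 1 := h
  exact mul_inv_eq_iff_eq_mul.1 (eq_inv_of_mul_eq_one_left h)

theorem conj_handleGen_mem_range (j : Fin k ⊕ Fin k) (n : ℤ) :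
    stableGen k ^ n * handleGen k j * (stableGen k ^ n)⁻¹ ∈ (coverHom k).range :=
  ⟨FreeGroup.of (some (j, n)), by simp [coverHom]⟩

theorem dualGen_mem_range : dualGen k ∈ (coverHom k).range :=
  ⟨FreeGroup.of none, by simp [coverHom]⟩

theorem conj_handleRelator_mem_range (n : ℤ) :
    stableGen k ^ n * handleRelator k * (stableGen k ^ n)⁻¹ ∈ (coverHom k).range := by
  have h : stableGen k ^ n * handleRelator k * (stableGen k ^ n)⁻¹ =
      MulAut.conj (stableGen k ^ n) (handleRelator k) := rfl
  rw [h, handleRelator, map_list_prod, List.map_ofFn]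
  refine Subgroup.list_prod_mem _ fun x hx => ?_
  obtain ⟨i, rfl⟩ := (List.mem_ofFn' _ _).1 hx
  simp only [Function.comp_apply, map_mul, map_inv, MulAut.conj_apply]
  have h1 := conj_handleGen_mem_range k (Sum.inl i) n
  have h2 := conj_handleGen_mem_range k (Sum.inr i) n
  exact mul_mem (mul_mem (mul_mem h1 h2) (inv_mem h1)) (inv_mem h2)

theorem stableGen_conj_dualGen_mem_range :
    stableGen k * dualGen k * (stableGen k)⁻¹ ∈ (coverHom k).range := by
  rw [stableGen_conj_dualGen]
  have h := conj_handleRelator_mem_range k 0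
  simp only [zpow_zero, one_mul, inv_one, mul_one] at h
  exact mul_mem (inv_mem h) (dualGen_mem_range k)

theorem stableGen_inv_conj_dualGen_mem_range :
    (stableGen k)⁻¹ * dualGen k * stableGen k ∈ (coverHom k).range := by
  have h : (stableGen k)⁻¹ * dualGen k * stableGen k =
      (stableGen k ^ (-1 : ℤ) * handleRelator k * (stableGen k ^ (-1 : ℤ))⁻¹) * dualGen k := by
    have := stableGen_conj_dualGen k
    rw [mul_inv_eq_iff_eq_mul, mul_assoc, eq_inv_mul_iff_mul_eq] at this
    rw [zpow_neg_one, inv_inv, mul_assoc, ← this]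
    group
  rw [h]
  exact mul_mem (conj_handleRelator_mem_range k _) (dualGen_mem_range k)

theorem conj_coverHom_mem_range {t : StdSurfaceGroup (k + 1)} {e : ℤ} (ht : t = stableGen k ^ e)
    (hd : t * dualGen k * t⁻¹ ∈ (coverHom k).range) (m) (hm : m ∈ (coverHom k).range) :
    t * m * t⁻¹ ∈ (coverHom k).range := by
  obtain ⟨w, rfl⟩ := hm
  have key : (⊤ : Subgroup _) ≤
      (coverHom k).range.comap ((MulAut.conj t).toMonoidHom.comp (coverHom k)) := by
    rw [← FreeGroup.closure_range_of, Subgroup.closure_le]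
    rintro _ ⟨o, rfl⟩
    cases o with
    | none => simpa [coverHom] using hd
    | some x =>
      have h := conj_handleGen_mem_range k x.1 (e + x.2)
      rw [zpow_add, ← ht] at h
      simpa [coverHom, mul_assoc] using h
  exact key (Subgroup.mem_top w)

instance normal_range_coverHom : (coverHom k).range.Normal := by
  rw [← Subgroup.normalizer_eq_top_iff, ← top_le_iff,
    ← PresentedGroup.closure_range_of, Subgroup.closure_le]
  have ht : stableGen k ∈ Subgroup.normalizer ((coverHom k).range : Set _) := by
    rw [Subgroup.mem_normalizer_iff]
    intro m
    refine ⟨conj_coverHom_mem_range k (zpow_one _).symm (stableGen_conj_dualGen_mem_range k) m,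
      fun hm => ?_⟩
    have := conj_coverHom_mem_range k (t := (stableGen k)⁻¹) (e := -1) (by simp)
      (by simpa using stableGen_inv_conj_dualGen_mem_range k) _ hm
    simpa [mul_assoc] using this
  have hx : ∀ j, handleGen k j ∈ Subgroup.normalizer ((coverHom k).range : Set _) := fun j =>
    Subgroup.le_normalizer (by simpa using conj_handleGen_mem_range k j 0)
  rintro _ ⟨i | i, rfl⟩
  · refine Fin.cases ht (fun j => hx (Sum.inl j)) i
  · refine Fin.cases (Subgroup.le_normalizer (dualGen_mem_range k)) (fun j => hx (Sum.inr j)) i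

/-- Every element of a surface group is a product of an element of the image of `coverHom` (the
kernel of the map to `ℤ` sending `a₀` to `1` and the other generators to `0`) and a power
of `a₀`. -/
theorem exists_eq_coverHom_mul_zpow (r : StdSurfaceGroup (k + 1)) :
    ∃ w, ∃ n : ℤ, r = coverHom k w * stableGen k ^ n := by
  have htop : (⊤ : Subgroup (StdSurfaceGroup (k + 1))) ≤
      (coverHom k).range ⊔ Subgroup.zpowers (stableGen k) := by
    rw [← PresentedGroup.closure_range_of, Subgroup.closure_le]
    have hx : ∀ j, handleGen k j ∈ (coverHom k).range := fun j => by
      simpa using conj_handleGen_mem_range k j 0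
    rintro _ ⟨i | i, rfl⟩
    · exact Fin.cases (Subgroup.mem_sup_right (Subgroup.mem_zpowers (stableGen k)))
        (fun j => Subgroup.mem_sup_left (hx (Sum.inl j))) i
    · exact Fin.cases (Subgroup.mem_sup_left (dualGen_mem_range k))
        (fun j => Subgroup.mem_sup_left (hx (Sum.inr j))) i
  obtain ⟨_, ⟨w, rfl⟩, _, ⟨n, rfl⟩, h⟩ :=
    Subgroup.mem_sup_of_normal_left.1 (htop (Subgroup.mem_top r))
  exact ⟨w, n, h.symm⟩

variable {k}

theorem towerHom_stableGen {ℓ : ℕ} {P : Type*} [Group P] (θ : Fin k ⊕ Fin k → ZMod ℓ → P) :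
    towerHom θ (stableGen k) = stepPerm (handleProd θ) :=
  PresentedGroup.toGroup.of _

/-- On the kernel of the map to `ℤ`, the action on `ZMod ℓ × P × P` preserves the fibers over
`ZMod ℓ × P`; over `(0, β)` it is given by left multiplications. -/
theorem towerHom_coverHom {ℓ : ℕ} {P : Type*} [Group P] (θ : Fin k ⊕ Fin k → ZMod ℓ → P)
    (w : FreeGroup (Option ((Fin k ⊕ Fin k) × ℤ))) (β p : P) :
    towerHom θ (coverHom k w) (0, β, p) =
      (0, β, FreeGroup.lift (fun o => o.elim β fun x => θ x.1 ((-x.2 : ℤ) : ZMod ℓ)) w * p) := by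
  have hgen : ∀ j, towerHom θ (handleGen k j) = fiberPerm ℓ P fun n _ => θ j n := by
    rintro (j | j) <;> exact PresentedGroup.toGroup.of _
  let F : FreeGroup (Option ((Fin k ⊕ Fin k) × ℤ)) →* (ZMod ℓ → P → P) :=
    FreeGroup.lift fun o => o.elim (fun _ β => β) fun x n _ => θ x.1 (n - x.2)
  have h1 : (towerHom θ).comp (coverHom k) = (fiberPerm ℓ P).comp F := by
    ext1 o
    cases o with
    | none =>
      simp only [MonoidHom.comp_apply, coverHom, F, FreeGroup.lift_apply_of, Option.elim_none]
      exact PresentedGroup.toGroup.of _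
    | some x =>
      simp only [MonoidHom.comp_apply, coverHom, F, FreeGroup.lift_apply_of, Option.elim_some,
        map_mul, map_inv, map_zpow, towerHom_stableGen, hgen]
      exact stepPerm_zpow_conj_fiberPerm _ _ _
  have h2 : ((Pi.evalMonoidHom (fun _ : P => P) β).comp
      (Pi.evalMonoidHom (fun _ : ZMod ℓ => P → P) 0)).comp F =
      FreeGroup.lift (fun o => o.elim β fun x => θ x.1 ((-x.2 : ℤ) : ZMod ℓ)) := by
    ext1 o
    cases o <;> simp [F]
  rw [← MonoidHom.comp_apply, h1, ← h2]
  rfl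

end CyclicCover

/-! ### Residual finiteness of surface groups -/

theorem freeGroup_map_eq_self {α : Type*} [DecidableEq α] {f : α → α} {w : FreeGroup α}
    (h : ∀ x ∈ w.toWord, f x.1 = x.1) : FreeGroup.map f w = w := by
  conv_lhs => rw [← FreeGroup.mk_toWord (x := w)]
  rw [FreeGroup.map.mk]
  conv_rhs => rw [← FreeGroup.mk_toWord (x := w)]
  congr 1
  conv_rhs => rw [← List.map_id w.toWord]
  exact List.map_congr_left fun x hx => by simp [h x hx]

/-- For an element `coverHom w` with `w ≠ 1`, a finite quotient `P` of the free group not killing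
`w` gives an action on `ZMod ℓ × P × P` which moves a point of the fiber over `0` as soon as `ℓ` is
large compared with the heights occurring in `w`; the other elements `coverHom w * a₀ ^ n` move the
first coordinate. -/
instance residuallyFinite_stdSurfaceGroup (k : ℕ) :
    Group.ResiduallyFinite (StdSurfaceGroup (k + 1)) := by
  classical
  refine Group.residuallyFinite_of_forall_exists_finite_monoidHom fun r hr => ?_
  obtain ⟨w, n, rfl⟩ := exists_eq_coverHom_mul_zpow k r
  by_cases hn : n = 0
  · subst hn
    rw [zpow_zero, mul_one] at hr ⊢
    obtain ⟨H, hH⟩ := Group.exists_finiteIndexNormalSubgroup_notMem w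
      (fun h => hr (by rw [h, map_one]))
    let P := FreeGroup (Option ((Fin k ⊕ Fin k) × ℤ)) ⧸ H.toSubgroup
    have hP : Finite P := Subgroup.finite_quotient_of_finiteIndex
    let π : FreeGroup (Option ((Fin k ⊕ Fin k) × ℤ)) →* P := QuotientGroup.mk' H.toSubgroup
    have hπ : π w ≠ 1 := fun h => hH ((QuotientGroup.eq_one_iff w).1 h)
    obtain ⟨m, hm⟩ : ∃ m : ℕ, ∀ x ∈ w.toWord, ∀ y ∈ x.1, y.2.natAbs ≤ m := by
      induction w.toWord with
      | nil => exact ⟨0, by simp⟩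
      | cons x s ih =>
        obtain ⟨m, hm⟩ := ih
        obtain ⟨_ | y, e⟩ := x
        · exact ⟨m, by simpa using hm⟩
        · refine ⟨max m y.2.natAbs, fun x hx z hz => ?_⟩
          rcases List.mem_cons.1 hx with rfl | hx
          · rw [Option.mem_some_iff.1 hz]; exact le_max_right _ _
          · exact (hm x hx z hz).trans (le_max_left _ _)
    let ℓ := 2 * m + 1
    have : NeZero ℓ := ⟨by omega⟩
    -- `a₀ ^ n` shifts heights by `n`, so its conjugates act over `0` through the values at `-n`.
    let θ : Fin k ⊕ Fin k → ZMod ℓ → P := fun j z => π (FreeGroup.of (some (j, -z.valMinAbs)))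
    let e : Option ((Fin k ⊕ Fin k) × ℤ) → Option ((Fin k ⊕ Fin k) × ℤ) :=
      Option.map fun x => (x.1, -((-x.2 : ℤ) : ZMod ℓ).valMinAbs)
    have he : FreeGroup.map e w = w := by
      refine freeGroup_map_eq_self fun x hx => ?_
      obtain ⟨_ | y, b⟩ := x
      · rfl
      · have hy := hm _ hx y rfl
        have : ((-y.2 : ℤ) : ZMod ℓ).valMinAbs = -y.2 :=
          (ZMod.valMinAbs_spec _ _).2 ⟨rfl, by constructor <;> push_cast [ℓ] <;> omega⟩
        change some (y.1, -((-y.2 : ℤ) : ZMod ℓ).valMinAbs) = some y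
        rw [this, neg_neg]
    have hlift : FreeGroup.lift (fun o => o.elim (π (FreeGroup.of none))
        fun x => θ x.1 ((-x.2 : ℤ) : ZMod ℓ)) = π.comp (FreeGroup.map e) := by
      ext1 o
      cases o <;> simp [θ, e]
    refine ⟨Equiv.Perm (ZMod ℓ × P × P), inferInstance, inferInstance, towerHom θ,
      fun h => hπ ?_⟩
    have := towerHom_coverHom θ w (π (FreeGroup.of none)) 1
    rw [h, hlift, MonoidHom.comp_apply, he, mul_one] at this
    exact (congrArg (fun x => x.2.2) this).symm
  · let ℓ := n.natAbs + 1
    have : NeZero ℓ := ⟨by omega⟩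
    let θ : Fin k ⊕ Fin k → ZMod ℓ → Unit := fun _ _ => 1
    refine ⟨Equiv.Perm (ZMod ℓ × Unit × Unit), inferInstance, inferInstance, towerHom θ,
      fun h => hn ?_⟩
    have h1 : (stepPerm (handleProd θ) ^ n) (-n, 1, 1) = (0, 1, 1) := by
      ext
      simp [stepPerm_zpow_apply_fst]
    have h2 := congrArg (fun σ : Equiv.Perm (ZMod ℓ × Unit × Unit) => (σ (-n, 1, 1)).1) h
    simp only [map_mul, map_zpow, towerHom_stableGen, Equiv.Perm.mul_apply, h1,
      towerHom_coverHom, Equiv.Perm.one_apply] at h2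
    rw [eq_comm, neg_eq_zero, ZMod.intCast_zmod_eq_zero_iff_dvd] at h2
    exact Int.eq_zero_of_abs_lt_dvd h2 (by rw [Int.abs_eq_natAbs]; simp [ℓ])

/-! ### First properties of surface groups -/

namespace IsSurfaceGroup

variable {R : Type*} [Group R]

theorem residuallyFinite (hR : IsSurfaceGroup R) : Group.ResiduallyFinite R := by
  obtain ⟨g, hg, ⟨e⟩⟩ := hR
  obtain ⟨k, rfl⟩ : ∃ k, g = k + 1 := ⟨g - 1, by omega⟩
  rw [Group.residuallyFinite_iff_exists_finiteIndex]
  intro r hr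
  obtain ⟨H, hH⟩ := Group.exists_finiteIndexNormalSubgroup_notMem (e r) (by simpa using hr)
  exact ⟨(H.comap e.toMonoidHom).toSubgroup, inferInstance, hH⟩

theorem fg (hR : IsSurfaceGroup R) : Group.FG R := by
  obtain ⟨g, hg, ⟨e⟩⟩ := hR
  exact Group.fg_of_surjective (f := e.symm.toMonoidHom.comp (PresentedGroup.mk _))
    (e.symm.surjective.comp (PresentedGroup.mk_surjective _))

theorem exists_surjective_int (hR : IsSurfaceGroup R) :
    ∃ χ : R →* Multiplicative ℤ, Function.Surjective χ := by
  obtain ⟨g, hg, ⟨e⟩⟩ := hR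
  let v : Fin g ⊕ Fin g → Multiplicative ℤ := fun _ => Multiplicative.ofAdd 1
  have hv : ∀ r ∈ ({surfaceRelator g} : Set _), FreeGroup.lift v r = 1 := by
    rintro _ rfl
    rw [lift_surfaceRelator]
    refine List.prod_eq_one fun x hx => ?_
    obtain ⟨i, rfl⟩ := (List.mem_ofFn' _ _).1 hx
    simp [v]
  refine ⟨(PresentedGroup.toGroup hv).comp e.toMonoidHom, fun n => ?_⟩
  refine ⟨e.symm (PresentedGroup.of (Sum.inl ⟨0, by omega⟩)) ^ n.toAdd, ?_⟩
  rw [map_zpow]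
  have : (PresentedGroup.toGroup hv).comp e.toMonoidHom
      (e.symm (PresentedGroup.of (Sum.inl ⟨0, by omega⟩))) = Multiplicative.ofAdd 1 := by
    simp [v]
  rw [this, ← ofAdd_zsmul]
  simp

theorem nontrivial (hR : IsSurfaceGroup R) : Nontrivial R := by
  obtain ⟨χ, hχ⟩ := hR.exists_surjective_int
  exact hχ.nontrivial

end IsSurfaceGroup

/-! ### Crossed homomorphisms -/

section CrossedHom

variable {R W : Type*} [Group R] [AddCommGroup W] [Module ℚ W]

/-- The space of crossed homomorphisms (1-cocycles) `R → W`: maps such that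
`f (x y) = f x + x • f y`. -/
def crossedHoms (ρ : Representation ℚ R W) : Submodule ℚ (R → W) where
  carrier := {f | ∀ x y, f (x * y) = f x + ρ x (f y)}
  add_mem' hf hf' x y := by simp only [Pi.add_apply, hf x y, hf' x y, map_add]; abel
  zero_mem' x y := by simp
  smul_mem' c f hf x y := by simp only [Pi.smul_apply, hf x y, map_smul, smul_add]

variable {ρ : Representation ℚ R W} {f : R → W}

theorem crossedHom_one (hf : f ∈ crossedHoms ρ) : f 1 = 0 := by
  have := hf 1 1
  simpa using this

theorem crossedHom_inv (hf : f ∈ crossedHoms ρ) (x : R) : f x⁻¹ = -ρ x⁻¹ (f x) := by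
  have := hf x⁻¹ x
  rw [inv_mul_cancel, crossedHom_one hf] at this
  exact eq_neg_of_add_eq_zero_left this.symm

theorem crossedHom_conj (hf : f ∈ crossedHoms ρ) (x y : R) :
    f (y * x * y⁻¹) = f y + ρ y (f x) - ρ (y * x * y⁻¹) (f y) := by
  rw [hf, hf, crossedHom_inv hf, map_neg, ← Module.End.mul_apply, ← map_mul, sub_eq_add_neg]

/-- The elements where a crossed homomorphism vanishes form a subgroup. -/
def crossedHomZeros (hf : f ∈ crossedHoms ρ) : Subgroup R where
  carrier := {x | f x = 0}
  mul_mem' {x y} hx hy := by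
    rw [Set.mem_ofPred_eq] at *
    rw [hf, hx, hy, map_zero, add_zero]
  one_mem' := crossedHom_one hf
  inv_mem' {x} hx := by
    rw [Set.mem_ofPred_eq] at *
    rw [crossedHom_inv hf, hx, map_zero, neg_zero]

/-- A crossed homomorphism that vanishes on a normal subgroup without nonzero fixed vectors
vanishes: its values are fixed by the subgroup. -/
theorem crossedHom_eq_zero_of_vanishes (hf : f ∈ crossedHoms ρ) {L : Subgroup R} [L.Normal]
    (hL : ∀ w, (∀ l ∈ L, ρ l w = w) → w = 0) (h : ∀ l ∈ L, f l = 0) : f = 0 := by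
  ext x
  refine hL _ fun l hl => ?_
  have h1 : f (l * x) = ρ l (f x) := by rw [hf, h l hl, zero_add]
  have h2 : f (l * x) = f x := by
    have : l * x = x * (x⁻¹ * l * x) := by group
    have hmem : x⁻¹ * l * x ∈ L := by
      simpa only [inv_inv] using ‹L.Normal›.conj_mem l hl x⁻¹
    rw [this, hf, h _ hmem, map_zero, add_zero]
  rw [← h1, h2]

/-- On a free group, the values of a crossed homomorphism on the generators are arbitrary. -/
theorem exists_crossedHom_freeGroup {S : Type*} (ρ : Representation ℚ (FreeGroup S) W)
    (v : S → W) : ∃ f ∈ crossedHoms ρ, ∀ s, f (FreeGroup.of s) = v s := by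
  -- The affine action in which the generator `s` acts by `w ↦ v s + ρ s w`.
  let T : FreeGroup S →* Equiv.Perm W := FreeGroup.lift fun s =>
    { toFun := fun w => v s + ρ (FreeGroup.of s) w
      invFun := fun w => ρ (FreeGroup.of s)⁻¹ (w - v s)
      left_inv := fun w => by
        beta_reduce
        rw [add_sub_cancel_left, ← Module.End.mul_apply, ← map_mul]; simp
      right_inv := fun w => by
        beta_reduce
        rw [← Module.End.mul_apply, ← map_mul]; simp }
  have hT : ∀ x w w', T x w - T x w' = ρ x (w - w') := by
    intro x
    induction x using FreeGroup.induction_on with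
    | C1 => simp
    | of s => intro w w'; simp [T]
    | inv_of s ih =>
      intro w w'
      obtain ⟨a, rfl⟩ := (T (FreeGroup.of s)).surjective w
      obtain ⟨a', rfl⟩ := (T (FreeGroup.of s)).surjective w'
      rw [ih, ← Module.End.mul_apply, ← map_mul, map_inv]
      simp
    | mul x y hx hy => intro w w'; simp [hx, hy]
  refine ⟨fun x => T x 0, fun x y => ?_, fun s => by simp [T]⟩
  have := hT x (T y 0) 0
  rw [sub_zero, sub_eq_iff_eq_add'] at this
  simpa using this

/-- A surface group has only one defining relation but at least four generators, so its crossed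
homomorphisms to `W` form a space of dimension at least `3 dim W`; one linear condition with
values in `W` is therefore satisfied by a nonzero one. -/
theorem IsSurfaceGroup.exists_crossedHom (hR : IsSurfaceGroup R) [FiniteDimensional ℚ W]
    [Nontrivial W] (ρ : Representation ℚ R W) {ι : Type*} [Fintype ι] (x : ι → R) :
    ∃ f ∈ crossedHoms ρ, f ≠ 0 ∧ ∑ i, f (x i) = 0 := by
  obtain ⟨g, hg, ⟨e⟩⟩ := hR
  let S := Fin g ⊕ Fin g
  let π : FreeGroup S →* R := e.symm.toMonoidHom.comp (PresentedGroup.mk {surfaceRelator g})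
  have hπ : Function.Surjective π := e.symm.surjective.comp (PresentedGroup.mk_surjective _)
  have hker : ∀ x, π x = 1 → x ∈ Subgroup.normalClosure {surfaceRelator g} := fun x hx =>
    PresentedGroup.mk_eq_one_iff.1 (by simpa [π] using hx)
  let ρ' : Representation ℚ (FreeGroup S) W := ρ.comp π
  let ev : crossedHoms ρ' →ₗ[ℚ] (S → W) :=
    (LinearMap.funLeft ℚ W FreeGroup.of).comp (crossedHoms ρ').subtype
  have hev : Function.Surjective ev := fun v => by
    obtain ⟨f, hf, hv⟩ := exists_crossedHom_freeGroup ρ' v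
    exact ⟨⟨f, hf⟩, funext hv⟩
  obtain ⟨E, hE⟩ := ev.exists_rightInverse_of_surjective (LinearMap.range_eq_top.2 hev)
  choose y hy using fun i => hπ (x i)
  let E' : (S → W) →ₗ[ℚ] (FreeGroup S → W) := (crossedHoms ρ').subtype.comp E
  let Φ : (S → W) →ₗ[ℚ] W × W := LinearMap.prod
    ((LinearMap.proj (surfaceRelator g)).comp E')
    ((∑ i, (LinearMap.proj (y i) : (FreeGroup S → W) →ₗ[ℚ] W)).comp E')
  have hdim : Module.finrank ℚ (W × W) < Module.finrank ℚ (S → W) := by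
    rw [Module.finrank_prod, Module.finrank_pi_fintype]
    have := Module.finrank_pos (R := ℚ) (M := W)
    simp only [S, Finset.sum_const, Finset.card_univ, Fintype.card_sum, Fintype.card_fin,
      smul_eq_mul]
    nlinarith
  obtain ⟨v, hv, hv0⟩ := Submodule.exists_mem_ne_zero_of_ne_bot
    (LinearMap.ker_ne_bot_of_finrank_lt (f := Φ) hdim)
  rw [LinearMap.mem_ker] at hv
  have hf : E' v ∈ crossedHoms ρ' := (E v).2
  set f := E' v
  have hfv : ∀ s, f (FreeGroup.of s) = v s := fun s => congrFun (LinearMap.congr_fun hE v) s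
  have hrel : f (surfaceRelator g) = 0 := congrArg Prod.fst hv
  have hsum : ∑ i, f (y i) = 0 := by simpa [Φ] using congrArg Prod.snd hv
  have hzero : ∀ n, π n = 1 → f n = 0 := by
    intro n hn
    have hnormal : (crossedHomZeros hf ⊓ π.ker).Normal := ⟨fun n hn y =>
      ⟨?_, π.normal_ker.conj_mem n hn.2 y⟩⟩
    · have hle : Subgroup.normalClosure {surfaceRelator g} ≤ crossedHomZeros hf ⊓ π.ker :=
        Subgroup.normalClosure_le_normal (by
          rintro _ rfl
          exact ⟨hrel, by simp [π, PresentedGroup.one_of_mem]⟩)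
      exact (hle (hker n hn)).1
    · have h1 : f n = 0 := hn.1
      have h2 : π n = 1 := hn.2
      change f (y * n * y⁻¹) = 0
      rw [crossedHom_conj hf, h1]
      simp [ρ', h2]
  have hwell : ∀ a b, π a = π b → f a = f b := by
    intro a b hab
    have : a = b * (b⁻¹ * a) := by group
    rw [this, hf, hzero (b⁻¹ * a) (by simp [hab]), map_zero, add_zero]
  let s := Function.surjInv hπ
  have hs : ∀ r, π (s r) = r := Function.surjInv_eq hπ
  refine ⟨fun r => f (s r), fun a b => ?_, fun h => hv0 ?_, ?_⟩
  · have : f (s (a * b)) = f (s a * s b) := hwell _ _ (by simp [hs])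
    beta_reduce
    rw [this, hf]
    simp [ρ', hs]
  · ext i
    rw [← hfv, ← hwell (s (π (FreeGroup.of i))) _ (hs _)]
    exact congrFun h _
  · rw [← hsum]
    exact Finset.sum_congr rfl fun i _ => hwell _ _ (by rw [hs, hy])

end CrossedHom

/-! ### Representations of finite groups without fixed vectors -/

section Norm

variable {P : Type*} [Group P]

theorem sum_normal_conj (A : Subgroup P) [A.Normal] [Fintype A] (F : P → ℚ) (g : P) :
    ∑ a : A, F (g * a * g⁻¹) = ∑ a : A, F a :=
  (MulAut.conjNormal g : MulAut A).toEquiv.sum_comp fun a : A => F a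

/-- Functions on `P`, with `P` acting by left translations. -/
def translationRep (P : Type*) [Group P] : Representation ℚ P (P → ℚ) where
  toFun g := LinearMap.funLeft ℚ ℚ fun x => g⁻¹ * x
  map_one' := by ext; simp
  map_mul' g h := by ext; simp [LinearMap.funLeft, mul_assoc]

theorem translationRep_apply (g : P) (φ : P → ℚ) (x : P) :
    translationRep P g φ x = φ (g⁻¹ * x) := rfl

variable [Fintype P]

open Classical in
/-- The operator `φ ↦ (x ↦ ∑ a ∈ A, φ (a x))` on the functions on a finite group. -/
noncomputable def normOp (A : Subgroup P) : (P → ℚ) →ₗ[ℚ] (P → ℚ) where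
  toFun φ x := ∑ a : A, φ (a * x)
  map_add' φ ψ := by ext x; simp [Finset.sum_add_distrib]
  map_smul' c φ := by ext x; simp [Finset.mul_sum]

theorem normOp_apply (A : Subgroup P) [Fintype A] (φ : P → ℚ) (x : P) :
    normOp A φ x = ∑ a : A, φ (a * x) := by
  simp only [normOp, LinearMap.coe_mk, AddHom.coe_mk]
  convert rfl

theorem normOp_normOp (A : Subgroup P) (φ : P → ℚ) :
    normOp A (normOp A φ) = (Nat.card A : ℚ) • normOp A φ := by
  classical
  ext x
  simp only [normOp_apply, Pi.smul_apply, ← mul_assoc]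
  rw [Finset.sum_congr rfl fun a _ => ?_, Finset.sum_const, Finset.card_univ,
    ← Nat.card_eq_fintype_card, nsmul_eq_mul, smul_eq_mul]
  exact Equiv.sum_comp (Equiv.mulRight a) fun b : A => φ (b * x)

theorem normOp_comm (A B : Subgroup P) [A.Normal] (φ : P → ℚ) :
    normOp A (normOp B φ) = normOp B (normOp A φ) := by
  classical
  ext x
  simp only [normOp_apply]
  rw [Finset.sum_comm]
  refine Finset.sum_congr rfl fun b _ => ?_
  rw [← sum_normal_conj A (fun a => φ (a * (b * x))) b]
  simp [mul_assoc]

theorem normOp_translationRep (A : Subgroup P) [A.Normal] (g : P) (φ : P → ℚ) :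
    normOp A (translationRep P g φ) = translationRep P g (normOp A φ) := by
  classical
  ext x
  simp only [normOp_apply, translationRep_apply]
  rw [← sum_normal_conj A (fun a => φ (a * (g⁻¹ * x))) g⁻¹]
  simp [mul_assoc]

theorem eq_zero_of_normOp_eq_zero {A : Subgroup P} {φ : P → ℚ} (h : normOp A φ = 0)
    (hfix : ∀ a ∈ A, translationRep P a φ = φ) : φ = 0 := by
  classical
  ext x
  have h1 : normOp A φ x = 0 := congrFun h x
  have h2 : ∀ a : A, φ (a * x) = φ x := fun a => by
    have := congrFun (hfix _ (inv_mem a.2)) x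
    rwa [translationRep_apply, inv_inv] at this
  simp only [normOp_apply, h2, Finset.sum_const, Finset.card_univ, nsmul_eq_mul] at h1
  simpa using h1

/-- If `A` and `B` are nontrivial normal subgroups, the function
`(|A| - N_A) (|B| - N_B) δ₁` is killed by both norm operators and is nonzero at `1`. -/
theorem exists_normOp_eq_zero (A B : Subgroup P) [A.Normal] [B.Normal] (hA : A ≠ ⊥)
    (hB : B ≠ ⊥) : ∃ φ : P → ℚ, φ ≠ 0 ∧ normOp A φ = 0 ∧ normOp B φ = 0 := by
  classical
  let δ : P → ℚ := Pi.single 1 1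
  have hδ0 : ∀ x, 0 ≤ δ x := fun x => by
    simp only [δ, Pi.single_apply]; split_ifs <;> norm_num
  have hδ : ∀ C : Subgroup P, normOp C δ 1 = 1 := fun C => by
    rw [normOp_apply, Finset.sum_eq_single 1] <;> simp +contextual [δ]
  have hpos : 0 < normOp A (normOp B δ) 1 := by
    rw [normOp_apply]
    refine Finset.sum_pos' (fun a _ => ?_) ⟨1, Finset.mem_univ _, ?_⟩
    · rw [normOp_apply]; exact Finset.sum_nonneg fun b _ => hδ0 _
    · rw [Subgroup.coe_one, mul_one, hδ]; exact one_pos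
  have hcard : ∀ C : Subgroup P, C ≠ ⊥ → (2 : ℚ) ≤ Nat.card C := fun C hC => by
    exact_mod_cast (Subgroup.one_lt_card_iff_ne_bot C).2 hC
  refine ⟨(Nat.card A : ℚ) • ((Nat.card B : ℚ) • δ - normOp B δ) -
    normOp A ((Nat.card B : ℚ) • δ - normOp B δ), fun h => ?_, ?_, ?_⟩
  · have h1 := congrFun h 1
    have hδ1 : δ 1 = 1 := by simp [δ]
    simp only [Pi.sub_apply, Pi.smul_apply, map_sub, map_smul, hδ, hδ1, smul_eq_mul, mul_one,
      Pi.zero_apply] at h1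
    nlinarith [hcard A hA, hcard B hB]
  · simp only [map_sub, map_smul, normOp_normOp]
    module
  · simp only [map_sub, map_smul, normOp_comm A B, normOp_normOp, sub_self, smul_zero]

end Norm

/-- For two nontrivial normal subgroups of a finite group, some nonzero representation has no
nonzero vector fixed by one of them. -/
theorem exists_representation_of_finite {P : Type*} [Group P] [Fintype P] (A B : Subgroup P)
    [A.Normal] [B.Normal] (hA : A ≠ ⊥) (hB : B ≠ ⊥) :
    ∃ (W : Submodule ℚ (P → ℚ)) (ρ : Representation ℚ P W), Nontrivial W ∧
      (∀ w, (∀ a ∈ A, ρ a w = w) → w = 0) ∧ (∀ w, (∀ b ∈ B, ρ b w = w) → w = 0) := by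
  let W : Submodule ℚ (P → ℚ) := LinearMap.ker (normOp A) ⊓ LinearMap.ker (normOp B)
  have hW : ∀ g, ∀ φ ∈ W, translationRep P g φ ∈ W := fun g φ hφ => by
    obtain ⟨h1, h2⟩ := hφ
    constructor
    · change normOp A (translationRep P g φ) = 0
      rw [normOp_translationRep, show normOp A φ = 0 from h1, map_zero]
    · change normOp B (translationRep P g φ) = 0
      rw [normOp_translationRep, show normOp B φ = 0 from h2, map_zero]
  let ρ : Representation ℚ P W :=
    { toFun := fun g => (translationRep P g).restrict (hW g)
      map_one' := by ext w x; simp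
      map_mul' := fun g h => by ext w x; simp }
  have hρ : ∀ g (w : W), (ρ g w : P → ℚ) = translationRep P g w := fun g w => rfl
  refine ⟨W, ρ, ?_, fun w h => ?_, fun w h => ?_⟩
  · obtain ⟨φ, h0, h1, h2⟩ := exists_normOp_eq_zero A B hA hB
    exact ⟨⟨φ, h1, h2⟩, 0, fun h => h0 (congrArg Subtype.val h)⟩
  · exact Subtype.ext (eq_zero_of_normOp_eq_zero w.2.1 fun a ha => by rw [← hρ, h a ha])
  · exact Subtype.ext (eq_zero_of_normOp_eq_zero w.2.2 fun b hb => by rw [← hρ, h b hb])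

theorem exists_representation_of_residuallyFinite {R : Type*} [Group R]
    [Group.ResiduallyFinite R] (A B : Subgroup R) [A.Normal] [B.Normal] (hA : A ≠ ⊥)
    (hB : B ≠ ⊥) :
    ∃ (N : Subgroup R) (_ : N.Normal) (_ : Fintype (R ⧸ N)) (W : Submodule ℚ (R ⧸ N → ℚ))
      (ρ : Representation ℚ (R ⧸ N) W), Nontrivial W ∧
      (∀ w, (∀ a ∈ A, ρ (QuotientGroup.mk' N a) w = w) → w = 0) ∧
      (∀ w, (∀ b ∈ B, ρ (QuotientGroup.mk' N b) w = w) → w = 0) := by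
  obtain ⟨a, ha, ha1⟩ := A.bot_or_exists_ne_one.resolve_left hA
  obtain ⟨b, hb, hb1⟩ := B.bot_or_exists_ne_one.resolve_left hB
  obtain ⟨H, hH⟩ := Group.exists_finiteIndexNormalSubgroup_notMem a ha1
  obtain ⟨K, hK⟩ := Group.exists_finiteIndexNormalSubgroup_notMem b hb1
  let N : Subgroup R := H.toSubgroup ⊓ K.toSubgroup
  have hfin : Finite (R ⧸ N) := Subgroup.finite_quotient_of_finiteIndex
  let _ : Fintype (R ⧸ N) := Fintype.ofFinite _
  let θ := QuotientGroup.mk' N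
  have hθ : Function.Surjective θ := QuotientGroup.mk'_surjective N
  have : (A.map θ).Normal := ‹A.Normal›.map θ hθ
  have : (B.map θ).Normal := ‹B.Normal›.map θ hθ
  have hA' : A.map θ ≠ ⊥ := fun h => hH <| by
    have h1 : θ a ∈ A.map θ := Subgroup.mem_map_of_mem θ ha
    rw [h, Subgroup.mem_bot] at h1
    exact ((QuotientGroup.eq_one_iff a).1 h1).1
  have hB' : B.map θ ≠ ⊥ := fun h => hK <| by
    have h1 : θ b ∈ B.map θ := Subgroup.mem_map_of_mem θ hb
    rw [h, Subgroup.mem_bot] at h1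
    exact ((QuotientGroup.eq_one_iff b).1 h1).2
  obtain ⟨W, ρ, h0, h1, h2⟩ := exists_representation_of_finite (A.map θ) (B.map θ) hA' hB'
  refine ⟨N, inferInstance, inferInstance, W, ρ, h0, fun w h => h1 w ?_, fun w h => h2 w ?_⟩
  · rintro _ ⟨a, ha, rfl⟩; exact h a ha
  · rintro _ ⟨b, hb, rfl⟩; exact h b hb

/-! ### Normal subgroups of surface groups -/

/-- Two commuting normal subgroups `L` and `X` of a surface group are not both nontrivial. Indeed,
let `W` be a representation through a finite quotient in which neither `L` nor `X` fixes a nonzero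
vector. A crossed homomorphism `f` to `W` vanishes on the elements of `X` that act trivially,
because `L` fixes its values there. If moreover `f` has average zero on `X`, it vanishes on `X`,
hence on `L`, because `X` fixes its values there, hence everywhere. -/
theorem IsSurfaceGroup.false_of_commute {R : Type*} [Group R] (hR : IsSurfaceGroup R)
    {L X : Subgroup R} [L.Normal] [X.Normal] (hL : L ≠ ⊥) (hX : X ≠ ⊥)
    (hc : ∀ l ∈ L, ∀ x ∈ X, l * x = x * l) : False := by
  classical
  have := hR.residuallyFinite
  obtain ⟨N, _, _, W, ρ, _, hWL, hWX⟩ := exists_representation_of_residuallyFinite L X hL hX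
  let θ := QuotientGroup.mk' N
  let σ : Representation ℚ R W := ρ.comp θ
  have hsec : ∀ p : X.map θ, ∃ x ∈ X, θ x = p := fun p => p.2
  choose y hyX hy using hsec
  obtain ⟨f, hf, hf0, hsum⟩ := hR.exists_crossedHom σ y
  have hker : ∀ x ∈ X, θ x = 1 → f x = 0 := fun x hx h1 => hWL _ fun l hl => by
    have h := congrArg f (hc l hl x hx)
    rw [hf, hf, show σ x = 1 by simp [σ, h1], Module.End.one_apply, add_comm] at h
    exact add_right_cancel h
  have hwell : ∀ x ∈ X, ∀ x' ∈ X, θ x = θ x' → f x = f x' := fun x hx x' hx' h => by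
    rw [← mul_inv_cancel_left x' x, hf, hker _ (mul_mem (inv_mem hx') hx) (by simp [h]),
      map_zero, add_zero]
  have hfX : ∀ x ∈ X, f x = 0 := fun x hx => by
    have h1 : ∑ p, f (x * y p) = (Fintype.card (X.map θ) : ℚ) • f x := by
      simp only [hf x, Finset.sum_add_distrib, ← map_sum, hsum, map_zero, add_zero,
        Finset.sum_const, Finset.card_univ, Nat.cast_smul_eq_nsmul]
    have h2 : ∑ p, f (x * y p) = ∑ p, f (y p) := by
      let a : X.map θ := ⟨θ x, Subgroup.mem_map_of_mem θ hx⟩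
      rw [← Equiv.sum_comp (Equiv.mulLeft a) fun p => f (y p)]
      exact Finset.sum_congr rfl fun p _ =>
        hwell _ (mul_mem hx (hyX p)) _ (hyX _) (by simp [hy, a])
    rw [h2, hsum, eq_comm, smul_eq_zero] at h1
    exact h1.resolve_left (by exact_mod_cast Fintype.card_ne_zero)
  have hfL : ∀ l ∈ L, f l = 0 := fun l hl => hWX _ fun x hx => by
    have h := congrArg f (hc l hl x hx)
    rw [hf, hf, hfX x hx, map_zero, add_zero, zero_add] at h
    exact h.symm
  exact hf0 (crossedHom_eq_zero_of_vanishes hf hWL hfL)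

theorem IsSurfaceGroup.eq_one_of_commute {R : Type*} [Group R] (hR : IsSurfaceGroup R)
    {L : Subgroup R} [L.Normal] (hL : L ≠ ⊥) {x : R} (hx : ∀ l ∈ L, x * l = l * x) : x = 1 := by
  by_contra h
  have hX : Subgroup.centralizer (L : Set R) ≠ ⊥ := fun hbot => h <| by
    rw [← Subgroup.mem_bot, ← hbot, Subgroup.mem_centralizer_iff]
    exact fun l hl => (hx l hl).symm
  exact hR.false_of_commute hL hX fun l hl x hx => Subgroup.mem_centralizer_iff.1 hx l hl

theorem finiteDimensional_crossedHoms {L W : Type*} [Group L] [Group.FG L] [AddCommGroup W]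
    [Module ℚ W] [FiniteDimensional ℚ W] (ρ : Representation ℚ L W) :
    FiniteDimensional ℚ (crossedHoms ρ) := by
  obtain ⟨S, hS⟩ := Group.fg_def.1 ‹Group.FG L›
  let res : crossedHoms ρ →ₗ[ℚ] (S → W) :=
    (LinearMap.funLeft ℚ W Subtype.val).comp (crossedHoms ρ).subtype
  refine FiniteDimensional.of_injective res ((injective_iff_map_eq_zero res).2 fun f hf => ?_)
  have : (⊤ : Subgroup L) ≤ crossedHomZeros f.2 := by
    rw [← hS, Subgroup.closure_le]
    exact fun s hs => congrFun hf ⟨s, hs⟩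
  exact Subtype.ext (funext fun l => this (Subgroup.mem_top l))

/-- Let `r` act by conjugation on the crossed homomorphisms on a finitely generated normal
subgroup `L`. These form a finite-dimensional space, so some nonzero rational is not an
eigenvalue. -/
theorem exists_ne_zero_forall_conj_ne_smul {R W : Type*} [Group R] [AddCommGroup W]
    [Module ℚ W] [FiniteDimensional ℚ W] (ρ : Representation ℚ R W) (L : Subgroup R) [L.Normal]
    [Group.FG L] (r : R) :
    ∃ μ : ℚ, μ ≠ 0 ∧ ∀ c : L → W, (∀ l m : L, c (l * m) = c l + ρ l (c m)) →
      (∀ l, ρ r (c (MulAut.conjNormal r⁻¹ l)) = μ • c l) → c = 0 := by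
  let ρL : Representation ℚ L W := ρ.comp L.subtype
  have := finiteDimensional_crossedHoms ρL
  let A₀ : (L → W) →ₗ[ℚ] (L → W) :=
    { toFun := fun c l => ρ r (c (MulAut.conjNormal r⁻¹ l))
      map_add' := fun c d => by ext1 l; simp
      map_smul' := fun a c => by ext1 l; simp }
  have hA₀ : ∀ c ∈ crossedHoms ρL, A₀ c ∈ crossedHoms ρL := fun c hc l m => by
    have h : ρ r * ρL (MulAut.conjNormal r⁻¹ l) = ρ l * ρ r := by
      change ρ r * ρ (MulAut.conjNormal r⁻¹ l : L) = _
      rw [← map_mul, ← map_mul, MulAut.conjNormal_apply]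
      congr 1
      group
    change ρ r (c (MulAut.conjNormal r⁻¹ (l * m))) = ρ r (c (MulAut.conjNormal r⁻¹ l)) +
      ρ l (ρ r (c (MulAut.conjNormal r⁻¹ m)))
    rw [map_mul, hc, map_add, ← Module.End.mul_apply (ρ l), ← h, Module.End.mul_apply]
  let A : Module.End ℚ (crossedHoms ρL) := A₀.restrict hA₀
  have hfin : {μ : ℚ | A.HasEigenvalue μ}.Finite :=
    Module.End.finite_hasEigenvalue (R := ℚ) (M := crossedHoms ρL) A
  obtain ⟨μ, hμ⟩ := (hfin.union (Set.finite_singleton (0 : ℚ))).infinite_compl.nonempty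
  refine ⟨μ, fun h => hμ (Or.inr h), fun c hc hμc => ?_⟩
  by_contra hne
  refine hμ (Or.inl (Module.End.hasEigenvalue_of_hasEigenvector (x := ⟨c, hc⟩)
    ⟨Module.End.mem_eigenspace_iff.2 (Subtype.ext (funext hμc)),
      fun h => hne (congrArg Subtype.val h)⟩))

/-- Let `W` be a representation of a surface group in which the finitely generated normal
subgroup `L` fixes no nonzero vector. Then `L` is not killed by a surjection `χ` to `ℤ`. Indeed, let
`χ r = 1`. Twisting `W` by the character `μ⁻¹ ^ χ` changes nothing on `L`, but the restriction to `L`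
of a crossed homomorphism to the twist vanishing at `r` becomes an eigenvector for `μ` or zero. So
it is zero for a suitable `μ`, and all the crossed homomorphisms to the twist that vanish at `r`
are zero. -/
theorem IsSurfaceGroup.false_of_representation {R W : Type*} [Group R] [AddCommGroup W]
    [Module ℚ W] [FiniteDimensional ℚ W] [Nontrivial W] (hR : IsSurfaceGroup R)
    {L : Subgroup R} [L.Normal] [Group.FG L] (χ : R →* Multiplicative ℤ)
    (hχ : Function.Surjective χ) (hL : L ≤ χ.ker) (ρ : Representation ℚ R W)
    (hW : ∀ w, (∀ l ∈ L, ρ l w = w) → w = 0) : False := by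
  obtain ⟨r, hr⟩ := hχ (Multiplicative.ofAdd 1)
  obtain ⟨μ, hμ0, hμ⟩ := exists_ne_zero_forall_conj_ne_smul ρ L r
  let τ : Representation ℚ R W :=
    { toFun := fun x => (μ⁻¹ ^ (χ x).toAdd) • ρ x
      map_one' := by simp
      map_mul' := fun x y => by
        rw [map_mul, toAdd_mul, zpow_add₀ (inv_ne_zero hμ0), map_mul, smul_mul_smul_comm] }
  have hτ : ∀ x w, τ x w = (μ⁻¹ ^ (χ x).toAdd) • ρ x w := fun x w => rfl
  have hτL : ∀ l ∈ L, ∀ w, τ l w = ρ l w := fun l hl w => by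
    rw [hτ, show χ l = 1 from hL hl]; simp
  obtain ⟨f, hf, hf0, hfr⟩ := hR.exists_crossedHom τ (fun _ : Unit => r)
  replace hfr : f r = 0 := by simpa using hfr
  have hfL : (fun l : L => f l) = 0 := by
    refine hμ _ (fun l m => ?_) fun l => ?_
    · rw [Subgroup.coe_mul, hf, hτL l l.2]
    · have h := crossedHom_conj hf (MulAut.conjNormal r⁻¹ l : L) r
      rw [hfr, map_zero, zero_add, sub_zero, hτ, hr] at h
      simp only [MulAut.conjNormal_apply, inv_inv, toAdd_ofAdd, zpow_one] at h ⊢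
      rw [show r * (r⁻¹ * (l : R) * r) * r⁻¹ = l by group] at h
      rw [h, smul_inv_smul₀ hμ0]
  exact hf0 (crossedHom_eq_zero_of_vanishes hf (L := L)
    (fun w h => hW w fun l hl => (hτL l hl w).symm.trans (h l hl))
    fun l hl => congrFun hfL ⟨l, hl⟩)

theorem IsSurfaceGroup.eq_bot_of_fg_of_le_ker {R : Type*} [Group R] (hR : IsSurfaceGroup R)
    {L : Subgroup R} [L.Normal] [Group.FG L] (χ : R →* Multiplicative ℤ)
    (hχ : Function.Surjective χ) (hL : L ≤ χ.ker) : L = ⊥ := by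
  by_contra hL1
  have := hR.residuallyFinite
  obtain ⟨N, _, _, W, ρ, _, hW, -⟩ := exists_representation_of_residuallyFinite L L hL1 hL1
  exact hR.false_of_representation χ hχ hL (ρ.comp (QuotientGroup.mk' N)) hW

/-! ### Monodromy and centralizers -/

namespace GroupExtension

variable {R G Q : Type*} [Group R] [Group G] [Group Q]

/-- An element of the middle group that centralizes the kernel has trivial monodromy. -/
theorem rightHom_eq_one_of_commute (S : GroupExtension R G Q)
    (hS : Function.Injective S.monodromy) {z : G} (hz : ∀ r, z * S.inl r = S.inl r * z) :
    S.rightHom z = 1 := by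
  refine hS ?_
  rw [monodromy_rightHom, map_one]
  have : S.conjAct z = 1 := by
    ext r
    apply S.inl_injective
    rw [inl_conjAct_comm, hz, mul_inv_cancel_right, MulAut.one_apply]
  rw [this]
  rfl

/-- If only the trivial element centralizes the kernel, the monodromy is injective: an element
acting on the kernel as an inner automorphism differs from an element of the kernel by an element
of the centralizer. -/
theorem monodromy_injective_of_commute (S : GroupExtension R G Q)
    (hS : ∀ z : G, (∀ r, z * S.inl r = S.inl r * z) → z = 1) :
    Function.Injective S.monodromy := by
  rw [injective_iff_map_eq_one]
  intro q hq
  obtain ⟨y, rfl⟩ := S.rightHom_surjective q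
  rw [monodromy_rightHom, QuotientGroup.eq_one_iff] at hq
  obtain ⟨k, hk⟩ := hq
  have h := hS ((S.inl k)⁻¹ * y) fun r => by
    have h1 := S.inl_conjAct_comm (e := y) (n := r)
    rw [← hk, MulAut.conj_apply, map_mul, map_mul, map_inv, eq_mul_inv_iff_mul_eq] at h1
    rw [mul_assoc, ← h1]
    group
  rw [inv_mul_eq_one] at h
  rw [← h, S.rightHom_inl]

end GroupExtension

/-! ### Two surface fibrations of the same group -/

/-- Nested kernels of surjections onto surface groups are equal if the larger one is finitely
generated: its image in the quotient by the smaller one is a finitely generated normal subgroup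
killed by a surjection to `ℤ`. -/
theorem ker_eq_of_ker_le {N R₁ R₂ : Type*} [Group N] [Group R₁] [Group R₂]
    (hR₁ : IsSurfaceGroup R₁) (hR₂ : IsSurfaceGroup R₂) {u₁ : N →* R₁} {u₂ : N →* R₂}
    (hu₁ : Function.Surjective u₁) (hu₂ : Function.Surjective u₂) [Group.FG u₂.ker]
    (hle : u₁.ker ≤ u₂.ker) : u₁.ker = u₂.ker := by
  obtain ⟨χ, hχ⟩ := hR₂.exists_surjective_int
  have hlift : u₁.ker ≤ (χ.comp u₂).ker := fun x hx => by
    rw [MonoidHom.mem_ker, MonoidHom.comp_apply, show u₂ x = 1 from hle hx, map_one]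
  let χ₁ : R₁ →* Multiplicative ℤ := u₁.liftOfSurjective hu₁ ⟨χ.comp u₂, hlift⟩
  have hχ₁ : ∀ x, χ₁ (u₁ x) = χ (u₂ x) := fun x =>
    u₁.liftOfRightInverse_comp_apply _ (Function.rightInverse_surjInv hu₁) ⟨χ.comp u₂, hlift⟩ x
  have : (u₂.ker.map u₁).Normal := u₂.normal_ker.map u₁ hu₁
  have : Group.FG (u₂.ker.map u₁) :=
    Group.fg_of_surjective (u₁.subgroupMap_surjective u₂.ker)
  have hbot := hR₁.eq_bot_of_fg_of_le_ker (L := u₂.ker.map u₁) χ₁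
    (fun n => by
      obtain ⟨x, rfl⟩ := (hχ.comp hu₂) n
      exact ⟨u₁ x, hχ₁ x⟩)
    (by
      rintro _ ⟨x, hx, rfl⟩
      rw [MonoidHom.mem_ker, hχ₁, show u₂ x = 1 from hx, map_one])
  exact hle.antisymm ((Subgroup.map_eq_bot_iff _).1 hbot)

/-- In a surface-by-surface group with injective monodromy, two normal subgroups that centralize
each other and meet trivially are not both nontrivial. Indeed, the fiber `A` meets each of them
nontrivially, because its centralizer is trivial, and this produces two nontrivial commuting normal
subgroups of `A`. -/
theorem IsSurfaceBySurfaceWithInjectiveMonodromy.eq_bot_or_eq_bot {N : Type*} [Group N]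
    (hN : IsSurfaceBySurfaceWithInjectiveMonodromy N) {K L : Subgroup N} [K.Normal] [L.Normal]
    (hKL : Disjoint K L) : K = ⊥ ∨ L = ⊥ := by
  obtain ⟨A, _, hA, -, hinj⟩ := hN
  have hcent : ∀ z : N, (∀ a ∈ A, z * a = a * z) → z = 1 := fun z hz => by
    have h := (GroupExtension.ofNormal A).rightHom_eq_one_of_commute hinj (z := z)
      fun a => hz a a.2
    have hzA : z ∈ A := (QuotientGroup.eq_one_iff z).1 h
    have := hA.nontrivial
    have := hA.eq_one_of_commute (L := ⊤) top_ne_bot (x := ⟨z, hzA⟩)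
      fun a _ => Subtype.ext (hz a a.2)
    exact congrArg Subtype.val this
  have hmeet : ∀ M : Subgroup N, M.Normal → M ≠ ⊥ → M.subgroupOf A ≠ ⊥ := fun M hM hM1 h => by
    have hdisj : Disjoint M A := Subgroup.subgroupOf_eq_bot.1 h
    refine hM1 ((Subgroup.eq_bot_iff_forall M).2 fun z hz => hcent z fun a ha => ?_)
    exact Subgroup.commute_of_normal_of_disjoint M A hM ‹_› hdisj z a hz ha
  by_contra! hne
  refine hA.false_of_commute (hmeet K ‹_› hne.1) (hmeet L ‹_› hne.2) fun k hk l hl => ?_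
  exact Subtype.ext (Subgroup.commute_of_normal_of_disjoint K L ‹_› ‹_› hKL k l hk hl)

/-- The kernel of `u₁` has trivial centralizer in `G`. An element `z` centralizing it induces on
`R₂` an automorphism that is trivial on the nontrivial normal subgroup `u₂ (Ker u₁)`, hence trivial,
so `z` comes from an element `n` of `Ker u₂`. If `n ≠ 1`, then `Ker u₁ ⊓ Ker u₂` is trivial, being
a normal subgroup of `Ker u₂` that commutes with `n`; this contradicts
`IsSurfaceBySurfaceWithInjectiveMonodromy.eq_bot_or_eq_bot`. -/
theorem eq_one_of_commute_ker {N G Q R₁ R₂ H₂ : Type*} [Group N] [Group G] [Group Q]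
    [Group R₁] [Group R₂] [Group H₂]
    (S : GroupExtension N G Q) (hN : IsSurfaceBySurfaceWithInjectiveMonodromy N)
    (T₂ : GroupExtension R₂ H₂ Q) (hR₁ : IsSurfaceGroup R₁) (hR₂ : IsSurfaceGroup R₂)
    (hT₂ : Function.Injective T₂.monodromy) (f₂ : G →* H₂) (u₁ : N →* R₁) (u₂ : N →* R₂)
    (hu₁ : Function.Surjective u₁) (hu₂ : Function.Surjective u₂)
    (hK₁ : IsSurfaceGroup u₁.ker) (hK₂ : IsSurfaceGroup u₂.ker) (hK : u₁.ker ≠ u₂.ker)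
    (hleft₂ : f₂.comp S.inl = T₂.inl.comp u₂) (hright₂ : T₂.rightHom.comp f₂ = S.rightHom)
    {z : G} (hz : ∀ k ∈ u₁.ker, z * S.inl k = S.inl k * z) : z = 1 := by
  have hl : ∀ n, f₂ (S.inl n) = T₂.inl (u₂ n) := DFunLike.congr_fun hleft₂
  have hr : ∀ x, T₂.rightHom (f₂ x) = S.rightHom x := DFunLike.congr_fun hright₂
  have := hK₂.fg
  let M : Subgroup R₂ := u₁.ker.map u₂
  have hMn : M.Normal := u₁.normal_ker.map u₂ hu₂
  have hM : M ≠ ⊥ := fun h =>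
    hK (ker_eq_of_ker_le hR₁ hR₂ hu₁ hu₂ ((Subgroup.map_eq_bot_iff _).1 h))
  have hzM : ∀ m ∈ M, T₂.conjAct (f₂ z) m = m := by
    rintro _ ⟨k, hk, rfl⟩
    apply T₂.inl_injective
    rw [T₂.inl_conjAct_comm, ← hl, ← map_mul, hz k hk, map_mul, mul_inv_cancel_right]
  have hzR : ∀ x, T₂.conjAct (f₂ z) x = x := fun x => by
    have h : x⁻¹ * T₂.conjAct (f₂ z) x = 1 := hR₂.eq_one_of_commute hM fun m hm => by
      have h1 := hzM _ (hMn.conj_mem m hm x)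
      rw [map_mul, map_mul, map_inv, hzM m hm, mul_inv_eq_iff_eq_mul] at h1
      rw [mul_assoc, h1]
      group
    exact (inv_mul_eq_one.1 h).symm
  have hz1 : S.rightHom z = 1 := by
    rw [← hr]
    refine T₂.rightHom_eq_one_of_commute hT₂ fun x => ?_
    rw [← mul_inv_eq_iff_eq_mul, ← T₂.inl_conjAct_comm, hzR]
  obtain ⟨n, rfl⟩ : z ∈ S.inl.range := by rwa [S.range_inl_eq_ker_rightHom]
  have hn : ∀ k ∈ u₁.ker, n * k = k * n := fun k hk =>
    S.inl_injective (by rw [map_mul, map_mul, hz k hk])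
  have hn2 : u₂ n = 1 := hR₂.eq_one_of_commute hM (by
    rintro _ ⟨k, hk, rfl⟩
    rw [← map_mul, hn k hk, map_mul])
  by_contra hne
  have hdisj : Disjoint u₁.ker u₂.ker := by
    rw [← Subgroup.subgroupOf_eq_bot]
    by_contra hbot
    have h := hK₂.eq_one_of_commute hbot (x := ⟨n, hn2⟩) fun k hk => Subtype.ext (hn k hk)
    exact hne (by rw [show n = 1 from congrArg Subtype.val h, map_one])
  have h1 := hK₁.nontrivial
  have h2 := hK₂.nontrivial
  rw [Subgroup.nontrivial_iff_ne_bot] at h1 h2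
  exact (hN.eq_bot_or_eq_bot hdisj).elim h1 h2

theorem mainTheorem8 {N G Q R₁ H₁ R₂ H₂ : Type*} [Group N] [Group G] [Group Q]
    [Group R₁] [Group H₁] [Group R₂] [Group H₂]
    (S : GroupExtension N G Q) (hN : IsSurfaceBySurfaceWithInjectiveMonodromy N)
    (T₁ : GroupExtension R₁ H₁ Q) (T₂ : GroupExtension R₂ H₂ Q)
    (hR₁ : IsSurfaceGroup R₁) (hR₂ : IsSurfaceGroup R₂)
    (hT₁ : Function.Injective T₁.monodromy) (hT₂ : Function.Injective T₂.monodromy)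
    (f₁ : G →* H₁) (f₂ : G →* H₂) (u₁ : N →* R₁) (u₂ : N →* R₂)
    (hf₁ : Function.Surjective f₁) (hf₂ : Function.Surjective f₂)
    (hu₁ : Function.Surjective u₁) (hu₂ : Function.Surjective u₂)
    (hK₁ : IsSurfaceGroup u₁.ker) (hK₂ : IsSurfaceGroup u₂.ker) (hK : u₁.ker ≠ u₂.ker)
    (hleft₁ : f₁.comp S.inl = T₁.inl.comp u₁) (hright₁ : T₁.rightHom.comp f₁ = S.rightHom)
    (hleft₂ : f₂.comp S.inl = T₂.inl.comp u₂) (hright₂ : T₂.rightHom.comp f₂ = S.rightHom) :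
    Function.Injective (S.kerExtension T₁ u₁ f₁ hf₁ hleft₁ hright₁).monodromy ∧
      Function.Injective (S.kerExtension T₂ u₂ f₂ hf₂ hleft₂ hright₂).monodromy := by

  constructor
  · exact GroupExtension.monodromy_injective_of_commute _ fun z hz =>
      eq_one_of_commute_ker S hN T₂ hR₁ hR₂ hT₂ f₂ u₁ u₂ hu₁ hu₂ hK₁ hK₂ hK hleft₂ hright₂
        fun k hk => hz ⟨k, hk⟩
  · exact GroupExtension.monodromy_injective_of_commute _ fun z hz =>
      eq_one_of_commute_ker S hN T₁ hR₂ hR₁ hT₁ f₁ u₂ u₁ hu₂ hu₁ hK₂ hK₁ hK.symm hleft₁ hright₁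
        fun k hk => hz ⟨k, hk⟩
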